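/- Let $n\ge 0$ be an integer, let $\mathcal H^n$ be the $n$-dimensional Hausdorff measure on $\mathbb R^{n+1}$, and let $M\subset\mathbb R^{n+1}$, with $\mu=\mathcal H^n\llcorner M$. Suppose that: - $M$ is $n$-Ahlfors regular: $M$ is closed and there is a constant $C\ge 1$ such that $C^{-1}r^n\le\mu(B_r(x))\le C r^n$ for all $x\in M$ and $0<r<1$; - $M$ is countably $n$-rectifiable: $M$ is $\mathcal H^n$-measurable and $M\subset M_0\cup\bigcup_{i=1}^\infty F_i(A_i)$, where $\mathcal H^n(M_0)=0$ and each $F_i:A_i\to\mathbb R^{n+1}$ is a Lipschitz map on a set $A_i\subset\mathbb R^n$. An $n$-dimensional linear subspace $P\subset\mathbb R^{n+1}$ is the approximate tangent space $T_xM$ of $M$ at $x$ if $$\lim_{\lambda\to 0^+}\lambda^{-n}\int_M\varphi\big(\lambda^{-1}(y-x)\big)\,d\mathcal H^n(y)=\int_P\varphi\,d\mathcal H^n\qquad\text{for all }\varphi\in C^1_c(\mathbb R^{n+1},\mathbb R);$$ it is unique if it exists. For $h:\mathbb R^{n+1}\to\mathbb R$, the tangential gradient $\nabla^Mh(x)\in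 T_xM$ is the gradient at $x$ of the restriction of $h$ to the affine subspace $x+T_xM$; it exists if $T_xM$ exists and this restriction is differentiable at $x$. Let $f:M\to\mathbb R$ be Lipschitz, and let $\bar f:\mathbb R^{n+1}\to\mathbb R$ be any Lipschitz function with $\bar f=f$ on $M$ (for instance a McShane extension, whose Lipschitz constant is at most that of $f$). For $x\in M$ put $$\operatorname{Lip}f(x)=\lim_{r\to0^+}\ \sup_{y\in M\cap B_r(x),\ y\ne x}\frac{|f(y)-f(x)|}{|y-x|},$$ where the supremum of the empty set is $0$. Then for $\mu$-almost every $x\in M$ the tangential gradient $\nabla^M\bar f(x)$ exists and $$|\nabla^M\bar f(x)|\le\operatorname{Lip}f(x).$$ -/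

import Mathlib

open MeasureTheory Set Filter Topology
open scoped ENNReal NNReal

/-- `M ⊆ ℝ^{n+1}` is `n`-Ahlfors regular: `M` is closed and there is a constant `C ≥ 1` with
`C⁻¹ r ^ n ≤ (ℋⁿ ⌞ M) (B_r(x)) ≤ C r ^ n` for all `x ∈ M` and `0 < r < 1`. -/
def IsAhlforsRegular (n : ℕ) (M : Set (EuclideanSpace ℝ (Fin (n + 1)))) : Prop :=
  IsClosed M ∧ ∃ C : ℝ, 1 ≤ C ∧ ∀ x ∈ M, ∀ r : ℝ, 0 < r → r < 1 →
    ENNReal.ofReal (C⁻¹ * r ^ n) ≤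
        ((μH[(n : ℝ)] : Measure (EuclideanSpace ℝ (Fin (n + 1)))).restrict M) (Metric.ball x r) ∧
      ((μH[(n : ℝ)] : Measure (EuclideanSpace ℝ (Fin (n + 1)))).restrict M) (Metric.ball x r) ≤
        ENNReal.ofReal (C * r ^ n)

/-- `M ⊆ ℝ^{n+1}` is countably `n`-rectifiable: `M` is `ℋⁿ`-measurable (in the sense of
Carathéodory) and, up to an `ℋⁿ`-null set, it is covered by countably many Lipschitz images of
subsets of `ℝⁿ`. -/
def IsCountablyRectifiable (n : ℕ) (M : Set (EuclideanSpace ℝ (Fin (n + 1)))) : Prop :=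
  (μH[(n : ℝ)] : Measure (EuclideanSpace ℝ (Fin (n + 1)))).toOuterMeasure.IsCaratheodory M ∧
  ∃ (M₀ : Set (EuclideanSpace ℝ (Fin (n + 1))))
    (A : ℕ → Set (EuclideanSpace ℝ (Fin n)))
    (F : ℕ → EuclideanSpace ℝ (Fin n) → EuclideanSpace ℝ (Fin (n + 1))),
    μH[(n : ℝ)] M₀ = 0 ∧ (∀ i, ∃ K : ℝ≥0, LipschitzOnWith K (F i) (A i)) ∧
      M ⊆ M₀ ∪ ⋃ i, F i '' A i

/-- The `n`-dimensional linear subspace `P` is the approximate tangent space of `M` at `x`: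
`λ⁻ⁿ ∫_M φ(λ⁻¹ (y - x)) dℋⁿ(y) → ∫_P φ dℋⁿ` as `λ → 0⁺`, for every real-valued `φ ∈ C¹_c`.
(Such a subspace is unique when it exists.) -/
def IsApproxTangentSpace (n : ℕ) (M : Set (EuclideanSpace ℝ (Fin (n + 1))))
    (x : EuclideanSpace ℝ (Fin (n + 1)))
    (P : Submodule ℝ (EuclideanSpace ℝ (Fin (n + 1)))) : Prop :=
  Module.finrank ℝ P = n ∧
  ∀ φ : EuclideanSpace ℝ (Fin (n + 1)) → ℝ, ContDiff ℝ 1 φ → HasCompactSupport φ →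
    Tendsto (fun l : ℝ => (l ^ n)⁻¹ * ∫ y in M, φ (l⁻¹ • (y - x)) ∂μH[(n : ℝ)])
      (𝓝[>] 0) (𝓝 (∫ y in (P : Set (EuclideanSpace ℝ (Fin (n + 1)))), φ y ∂μH[(n : ℝ)]))

/-- `g` is the tangential gradient `∇^M h (x)`: the approximate tangent space `P = T_x M` exists,
and the restriction of `h` to the affine subspace `x + P` (parametrized by `P`) is differentiable
at `x` with gradient `g ∈ P`. -/
def HasTangentialGradientAt (n : ℕ) (M : Set (EuclideanSpace ℝ (Fin (n + 1))))
    (h : EuclideanSpace ℝ (Fin (n + 1)) → ℝ) (g x : EuclideanSpace ℝ (Fin (n + 1))) : Prop :=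
  ∃ P : Submodule ℝ (EuclideanSpace ℝ (Fin (n + 1))), IsApproxTangentSpace n M x P ∧
    ∃ v : P, (v : EuclideanSpace ℝ (Fin (n + 1))) = g ∧
      HasGradientAt (fun w : P => h (x + (w : EuclideanSpace ℝ (Fin (n + 1))))) v 0

/-- The local Lipschitz constant `Lip f (x) = lim_{r → 0} sup_{y ∈ B_r(x), y ≠ x} |f y - f x| / d(y, x)`
in a metric space `X`, with values in `[0, ∞]`. The supremum is monotone in `r`, so that the limit
is the infimum over `r > 0`; the supremum of the empty set is `0`. -/
noncomputable def localLip {X : Type*} [MetricSpace X] (f : X → ℝ) (x : X) : ℝ≥0∞ :=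
  ⨅ (r : ℝ) (_ : 0 < r), ⨆ (y : X) (_ : y ∈ Metric.ball x r) (_ : y ≠ x),
    ENNReal.ofReal (|f y - f x| / dist y x)

open MeasureTheory Set Filter Topology
open scoped ENNReal NNReal

set_option linter.unusedSectionVars false

/-! Extend the charts to Lipschitz maps `F` on all of `ℝⁿ`. Since Lipschitz maps send `ℋⁿ`-null sets
to `ℋⁿ`-null sets, Rademacher's theorem lets one assume, at almost every `y = F u` in `M`, that `F`
and `fbar ∘ F` are differentiable at `u`. A Sard-type lemma makes `T = DF(u)` injective as well. The
claim is that `T_y M` is the range of `T`.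

For each `ε`, the good parameters are covered by countably many sets `D` on which `F` differs from
`T` by a relative error `ε`, for every base point `u ∈ D`. Hence `ℋⁿ` on `F(D)` and on `T(D)` agree
up to a factor `(1 + 2ε)ⁿ`, with no Jacobian involved. At almost every point `D` has density one in
`ℝⁿ`, and `F(D)` has density one in `M` by Besicovitch differentiation and the upper Ahlfors bound.
So blow-ups of `M` at `F u` are squeezed onto the range of `T`, up to errors vanishing with `ε`
(`tendsto_setLIntegral_blowup`).

Differentiability along the tangent plane is inherited from `fbar ∘ F`, because `F u + T h` and `F
(u + h)` differ by `o(h)`. For the inequality, the blow-up limit forces `M` to come within `o(l)` of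
`x + l e` for every tangent vector `e`; taking `e` in the gradient direction compares the slope of
`fbar` with difference quotients of `f` on `M`. -/

/-! ### Comparison of Hausdorff measures of two images -/

/-- The hypothesis makes `f` factor through `g` on `s` by a `K`-Lipschitz map. No metric on `X` is
involved, so `F` and a linear model `T` can be used in either role. -/
theorem hausdorffMeasure_image_le_of_edist_le {X Y Z : Type*}
    [EMetricSpace Y] [MeasurableSpace Y] [BorelSpace Y]
    [EMetricSpace Z] [MeasurableSpace Z] [BorelSpace Z] {f : X → Y} {g : X → Z} {s : Set X}
    {K : ℝ≥0} (n : ℕ)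
    (h : ∀ p ∈ s, ∀ q ∈ s, edist (f p) (f q) ≤ K * edist (g p) (g q)) :
    μH[(n : ℝ)] (f '' s) ≤ (K : ℝ≥0∞) ^ n * μH[(n : ℝ)] (g '' s) := by
  rcases s.eq_empty_or_nonempty with rfl | ⟨p₀, -⟩
  · simp
  have : Nonempty X := ⟨p₀⟩
  have hc : ∀ p ∈ s, Function.invFunOn g s (g p) ∈ s ∧
      g (Function.invFunOn g s (g p)) = g p := fun p hp =>
    Function.invFunOn_pos ⟨p, hp, rfl⟩
  have hL : LipschitzOnWith K (f ∘ Function.invFunOn g s) (g '' s) := by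
    rintro _ ⟨p, hp, rfl⟩ _ ⟨q, hq, rfl⟩
    have := h _ (hc p hp).1 _ (hc q hq).1
    rwa [(hc p hp).2, (hc q hq).2] at this
  have himg : f '' s = (f ∘ Function.invFunOn g s) '' (g '' s) := by
    rw [image_image]
    refine image_congr fun p hp => ?_
    have := h _ hp _ (hc p hp).1
    rw [(hc p hp).2, edist_self, mul_zero] at this
    exact edist_le_zero.1 this
  rw [himg]
  simpa using hL.hausdorffMeasure_image_le (d := n) (Nat.cast_nonneg n)

section Comparison

variable {X Y Z : Type*} [MeasurableSpace X]
  [EMetricSpace Y] [MeasurableSpace Y] [BorelSpace Y]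
  [EMetricSpace Z] [MeasurableSpace Z] [BorelSpace Z]

/-- Measure form of the preceding bound, applied to `s ∩ f ⁻¹' B`. Pulling `ℋⁿ` back along the
linear model puts the integrals over the image of `F` and over the plane on one parameter space. -/
theorem restrict_image_le_smul_map_comap {f : X → Y} {g : X → Z} {s : Set X} {K : ℝ≥0} (n : ℕ)
    (hf : Measurable f) (hg : MeasurableEmbedding g)
    (h : ∀ p ∈ s, ∀ q ∈ s, edist (f p) (f q) ≤ K * edist (g p) (g q)) :
    (μH[(n : ℝ)] : Measure Y).restrict (f '' s) ≤
      (K : ℝ≥0∞) ^ n • (((μH[(n : ℝ)] : Measure Z).comap g).restrict s).map f := by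
  refine Measure.le_iff.2 fun B hB => ?_
  rw [Measure.restrict_apply hB, Measure.smul_apply, Measure.map_apply hf hB,
    Measure.restrict_apply (hf hB), hg.comap_apply, smul_eq_mul, inter_comm B, inter_comm _ s,
    ← image_inter_preimage]
  exact hausdorffMeasure_image_le_of_edist_le n fun p hp q hq => h p hp.1 q hq.1

theorem map_comap_le_smul_restrict_image {f : X → Y} {g : X → Z} {s : Set X} {K : ℝ≥0} (n : ℕ)
    (hf : Measurable f) (hg : MeasurableEmbedding g)
    (h : ∀ p ∈ s, ∀ q ∈ s, edist (g p) (g q) ≤ K * edist (f p) (f q)) :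
    (((μH[(n : ℝ)] : Measure Z).comap g).restrict s).map f ≤
      (K : ℝ≥0∞) ^ n • (μH[(n : ℝ)] : Measure Y).restrict (f '' s) := by
  refine Measure.le_iff.2 fun B hB => ?_
  rw [Measure.map_apply hf hB, Measure.restrict_apply (hf hB), Measure.smul_apply,
    Measure.restrict_apply hB, hg.comap_apply, smul_eq_mul, inter_comm B, inter_comm _ s,
    ← image_inter_preimage]
  exact hausdorffMeasure_image_le_of_edist_le n fun p hp q hq => h p hp.1 q hq.1

end Comparison

/-! ### Scaling of Hausdorff measure on a subspace -/

section Scaling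

open scoped Pointwise

variable {W : Type*} [NormedAddCommGroup W] [NormedSpace ℝ W] [MeasurableSpace W] [BorelSpace W]

theorem map_homothety_restrict_submodule (n : ℕ) (P : Submodule ℝ W) {t : W} (ht : t ∈ P)
    {l : ℝ} (hl : 0 < l) :
    ((μH[(n : ℝ)] : Measure W).restrict P).map (fun y => l⁻¹ • (y - t)) =
      ENNReal.ofReal (l ^ n) • (μH[(n : ℝ)] : Measure W).restrict P := by
  have hm : Measurable fun y : W => l⁻¹ • (y - t) := by fun_prop
  ext B hB
  rw [Measure.map_apply hm hB, Measure.restrict_apply (hm hB), Measure.smul_apply,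
    Measure.restrict_apply hB, smul_eq_mul]
  have : (fun y : W => l⁻¹ • (y - t)) ⁻¹' B ∩ P = (fun y => y + t) '' (l • (B ∩ (P : Set W))) := by
    ext y
    simp only [mem_inter_iff, mem_preimage, mem_image, SetLike.mem_coe]
    constructor
    · rintro ⟨h1, h2⟩
      exact ⟨l • (l⁻¹ • (y - t)), ⟨_, ⟨h1, P.smul_mem _ (P.sub_mem h2 ht)⟩, rfl⟩,
        by rw [smul_inv_smul₀ hl.ne', sub_add_cancel]⟩
    · rintro ⟨_, ⟨z, ⟨h1, h2⟩, rfl⟩, rfl⟩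
      rw [add_sub_cancel_right, inv_smul_smul₀ hl.ne']
      exact ⟨h1, P.add_mem (P.smul_mem _ h2) ht⟩
  rw [this, (isometry_add_right t).hausdorffMeasure_image (Or.inl (Nat.cast_nonneg n)),
    Measure.hausdorffMeasure_smul₀ (Nat.cast_nonneg n) hl.ne', NNReal.rpow_natCast,
    ENNReal.smul_def, smul_eq_mul, ENNReal.coe_pow, ENNReal.ofReal_pow hl.le]
  congr 2
  rw [← enorm_eq_nnnorm, Real.enorm_eq_ofReal hl.le]

theorem setLIntegral_submodule_homothety (n : ℕ) (P : Submodule ℝ W) {t : W} (ht : t ∈ P)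
    {l : ℝ} (hl : 0 < l) {φ : W → ℝ≥0∞} (hφ : Measurable φ) :
    ∫⁻ y in P, φ (l⁻¹ • (y - t)) ∂μH[(n : ℝ)] =
      ENNReal.ofReal (l ^ n) * ∫⁻ y in P, φ y ∂μH[(n : ℝ)] := by
  rw [← lintegral_map (μ := (μH[(n : ℝ)] : Measure W).restrict P) hφ
    (by fun_prop : Measurable fun y : W => l⁻¹ • (y - t)),
    map_homothety_restrict_submodule n P ht hl, lintegral_smul_measure, smul_eq_mul]

end Scaling

/-! ### Blow-ups along a tangent piece -/

theorem ENNReal.tendsto_of_forall_approx {ι : Type*} {F : Filter ι} {a : ι → ℝ≥0∞} {I c : ℝ≥0∞}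
    (hI : I ≠ ∞) (hc : c ≠ ∞) (n : ℕ) {ε : ℕ → ℝ≥0} (hε : Tendsto ε atTop (𝓝 0))
    (h : ∀ k, ∀ᶠ l in F, a l ≤ ε k + (1 + 2 * ε k) ^ n * (I + ε k * c) ∧
      I ≤ ε k + (1 + 2 * ε k) ^ n * a l + ε k * c) :
    Tendsto a F (𝓝 I) := by
  lift I to ℝ≥0 using hI
  lift c to ℝ≥0 using hc
  refine tendsto_order.2 ⟨fun b hb => ?_, fun b hb => ?_⟩
  · lift b to ℝ≥0 using (hb.trans_le le_top).ne
    have h1 : Tendsto (fun k => ε k + (1 + 2 * ε k) ^ n * b + ε k * c) atTop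
        (𝓝 (0 + (1 + 2 * 0) ^ n * b + 0 * c)) :=
      (hε.add (((hε.const_mul 2).const_add 1 |>.pow n).mul_const b)).add (hε.mul_const c)
    simp only [mul_zero, add_zero, one_pow, one_mul, zero_mul, zero_add] at h1
    obtain ⟨k, hk⟩ := (h1.eventually (gt_mem_nhds (ENNReal.coe_lt_coe.1 hb))).exists
    filter_upwards [h k] with l hl
    -- If `a l ≤ b`, the second estimate would bound `I` by a quantity that the choice of `k` makes
    -- smaller than `I`.
    by_contra! hle
    refine absurd (hl.2.trans ?_) (not_le.2 (ENNReal.coe_lt_coe.2 hk))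
    push_cast
    gcongr
  · have h1 : Tendsto (fun k => ((ε k + (1 + 2 * ε k) ^ n * (I + ε k * c) : ℝ≥0) : ℝ≥0∞)) atTop
        (𝓝 ((0 + (1 + 2 * 0) ^ n * (I + 0 * c) : ℝ≥0) : ℝ≥0∞)) :=
      ENNReal.tendsto_coe.2 (hε.add (((hε.const_mul 2).const_add 1 |>.pow n).mul
        ((hε.mul_const c).const_add I)))
    simp only [mul_zero, add_zero, one_pow, one_mul, zero_mul, zero_add] at h1
    obtain ⟨k, hk⟩ := (h1.eventually (gt_mem_nhds hb)).exists
    filter_upwards [h k] with l hl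
    refine hl.1.trans_lt ?_
    exact_mod_cast hk

/-- At `u`, the map `F` is `ε`-close to the linear map `T` on a set `E` which has density one at
`u`, and whose image has density one at `F u` as a subset of `M`. -/
structure IsTangentPiece {V W : Type*} [NormedAddCommGroup V] [NormedSpace ℝ V]
    [MeasurableSpace V] [BorelSpace V]
    [NormedAddCommGroup W] [NormedSpace ℝ W] [MeasurableSpace W] [BorelSpace W]
    (n : ℕ) (M : Set W) (F : V → W) (T : V →L[ℝ] W) (u : V) (ε : ℝ≥0) (E : Set V) : Prop where
  mem : u ∈ E
  measurableSet : MeasurableSet E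
  measurableSet_image : MeasurableSet (F '' E)
  image_subset : F '' E ⊆ M
  norm_sub_le : ∀ p ∈ E, ∀ q ∈ E, ‖F p - F q - T (p - q)‖ ≤ ε * ‖T (p - q)‖
  density_image : Tendsto (fun r : ℝ => μH[(n : ℝ)] ((M ∩ Metric.closedBall (F u) r) \ F '' E) /
    ENNReal.ofReal (r ^ n)) (𝓝[>] 0) (𝓝 0)
  density : Tendsto (fun r : ℝ => μH[(n : ℝ)] (Metric.closedBall u r \ E) /
    ENNReal.ofReal (r ^ n)) (𝓝[>] 0) (𝓝 0)

section Blowup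

variable {V W : Type*} [NormedAddCommGroup V] [NormedSpace ℝ V]
    [MeasurableSpace V] [BorelSpace V]
    [NormedAddCommGroup W] [NormedSpace ℝ W] [MeasurableSpace W] [BorelSpace W]

/-- Beyond radius `2R` the point `b` forces `‖a‖ ≥ ‖b‖ / 2 > R`, so both values vanish; within it,
`‖a - b‖ ≤ 2Rε`. The error is thus supported in a fixed ball and small with `ε`. -/
theorem LipschitzWith.le_add_indicator_closedBall {φ : W → ℝ≥0} {κ R ε : ℝ≥0}
    (hφ : LipschitzWith κ φ)
    (hR : ∀ y, (R : ℝ) < ‖y‖ → φ y = 0) (hε : ε ≤ 1 / 2) {a b : W} (h : ‖a - b‖ ≤ ε * ‖b‖) :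
    φ a ≤ φ b + (Metric.closedBall (0 : W) (2 * R)).indicator (fun _ => κ * ε * (2 * R)) b ∧
    φ b ≤ φ a + (Metric.closedBall (0 : W) (2 * R)).indicator (fun _ => κ * ε * (2 * R)) b := by
  by_cases hb : ‖b‖ ≤ 2 * R
  · rw [indicator_of_mem (by simpa using hb)]
    have h1 : nndist (φ a) (φ b) ≤ κ * ε * (2 * R) := by
      refine (hφ.nndist_le a b).trans ?_
      rw [mul_assoc]
      gcongr
      rw [nndist_eq_nnnorm]
      have : ‖a - b‖₊ ≤ ε * ‖b‖₊ := h
      refine this.trans ?_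
      gcongr
      exact hb
    constructor
    · exact (NNReal.le_add_nndist _ _).trans (by gcongr)
    · refine (NNReal.le_add_nndist _ (φ a)).trans ?_
      rw [nndist_comm]
      gcongr
  · have h0 : (0 : ℝ) ≤ R := R.2
    have hε' : (ε : ℝ) ≤ 1 / 2 := by exact_mod_cast hε
    push Not at hb
    have ha : (R : ℝ) < ‖a‖ := by
      have := norm_sub_norm_le b a
      rw [norm_sub_rev] at this
      nlinarith [norm_nonneg b]
    rw [hR a ha, hR b (by linarith)]
    simp

variable {n : ℕ} {M : Set W} {F : V → W} {T : V →L[ℝ] W} {u : V} {ε : ℝ≥0} {E : Set V}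

namespace IsTangentPiece

theorem edist_le (h : IsTangentPiece n M F T u ε E) {p q : V}
    (hp : p ∈ E) (hq : q ∈ E) : edist (F p) (F q) ≤ (1 + 2 * ε : ℝ≥0) * edist (T p) (T q) := by
  have h1 := h.norm_sub_le p hp q hq
  have h2 : nndist (F p) (F q) ≤ (1 + 2 * ε) * nndist (T p) (T q) := by
    rw [← NNReal.coe_le_coe]
    push_cast
    rw [dist_eq_norm, dist_eq_norm, ← map_sub]
    have := norm_add_le (F p - F q - T (p - q)) (T (p - q))
    rw [sub_add_cancel] at this
    nlinarith [norm_nonneg (T (p - q)), ε.2, mul_nonneg ε.2 (norm_nonneg (T (p - q)))]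
  rw [edist_nndist, edist_nndist]
  exact_mod_cast h2

theorem edist_le' (h : IsTangentPiece n M F T u ε E) (hε : ε ≤ 1 / 2) {p q : V}
    (hp : p ∈ E) (hq : q ∈ E) : edist (T p) (T q) ≤ (1 + 2 * ε : ℝ≥0) * edist (F p) (F q) := by
  have h1 := h.norm_sub_le p hp q hq
  have hε' : (ε : ℝ) ≤ 1 / 2 := by exact_mod_cast hε
  have h2 : nndist (T p) (T q) ≤ (1 + 2 * ε) * nndist (F p) (F q) := by
    rw [← NNReal.coe_le_coe]
    push_cast
    rw [dist_eq_norm, dist_eq_norm, ← map_sub]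
    have h3 := norm_sub_norm_le (T (p - q)) (F p - F q)
    rw [norm_sub_rev (T (p - q)) (F p - F q)] at h3
    have h4 : (1 - ε : ℝ) * ‖T (p - q)‖ ≤ ‖F p - F q‖ := by linarith
    -- The product is `1 + ε (1 - 2ε)`; this is where `ε ≤ 1/2` enters.
    have h5 : (1 : ℝ) ≤ (1 + 2 * ε) * (1 - ε) := by nlinarith [ε.2]
    calc ‖T (p - q)‖ ≤ ((1 + 2 * ε) * (1 - ε)) * ‖T (p - q)‖ :=
          le_mul_of_one_le_left (norm_nonneg _) h5
      _ = (1 + 2 * ε) * ((1 - ε) * ‖T (p - q)‖) := by ring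
      _ ≤ _ := by gcongr
  rw [edist_nndist, edist_nndist]
  exact_mod_cast h2

theorem norm_blowup_sub_le (h : IsTangentPiece n M F T u ε E) {w : V} (hw : w ∈ E) (l : ℝ) :
    ‖l⁻¹ • (F w - F u) - l⁻¹ • (T w - T u)‖ ≤ ε * ‖l⁻¹ • (T w - T u)‖ := by
  rw [← smul_sub, norm_smul, norm_smul, ← map_sub]
  calc _ ≤ ‖l⁻¹‖ * (ε * ‖T (w - u)‖) := by
        gcongr
        exact h.norm_sub_le w hw u h.mem
    _ = _ := by ring

theorem setLIntegral_image_le (h : IsTangentPiece n M F T u ε E) (hF : Measurable F)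
    (hT : MeasurableEmbedding T) {g : W → ℝ≥0∞} (hg : Measurable g) :
    ∫⁻ y in F '' E, g y ∂μH[(n : ℝ)] ≤
      (1 + 2 * ε : ℝ≥0∞) ^ n * ∫⁻ w in E, g (F w) ∂(μH[(n : ℝ)] : Measure W).comap T := by
  have := lintegral_mono' (restrict_image_le_smul_map_comap (f := F) (g := T) n hF hT
    fun p hp q hq => h.edist_le hp hq) (le_refl g)
  rw [lintegral_smul_measure, lintegral_map hg hF, smul_eq_mul] at this
  exact_mod_cast this

theorem le_setLIntegral_image (h : IsTangentPiece n M F T u ε E) (hε : ε ≤ 1 / 2)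
    (hF : Measurable F) (hT : MeasurableEmbedding T) {g : W → ℝ≥0∞} (hg : Measurable g) :
    ∫⁻ w in E, g (F w) ∂(μH[(n : ℝ)] : Measure W).comap T ≤
      (1 + 2 * ε : ℝ≥0∞) ^ n * ∫⁻ y in F '' E, g y ∂μH[(n : ℝ)] := by
  have := lintegral_mono' (map_comap_le_smul_restrict_image (f := F) (g := T) n hF hT
    fun p hp q hq => h.edist_le' hε hp hq) (le_refl g)
  rw [lintegral_smul_measure, lintegral_map hg hF, smul_eq_mul] at this
  exact_mod_cast this

theorem lintegral_comap_blowup (hT : MeasurableEmbedding T) (u : V) {l : ℝ} (hl : 0 < l)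
    {g : W → ℝ≥0∞} (hg : Measurable g) :
    ∫⁻ w, g (l⁻¹ • (T w - T u)) ∂(μH[(n : ℝ)] : Measure W).comap T =
      ENNReal.ofReal (l ^ n) * ∫⁻ y in (LinearMap.range (T : V →ₗ[ℝ] W) : Set W), g y ∂μH[(n : ℝ)] := by
  rw [← setLIntegral_submodule_homothety n _ (LinearMap.mem_range_self (T : V →ₗ[ℝ] W) u) hl hg]
  have := hT.lintegral_map (μ := (μH[(n : ℝ)] : Measure W).comap T)
    (fun y => g (l⁻¹ • (y - T u)))
  rw [← this, hT.map_comap]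
  rfl

variable {φ : W → ℝ≥0} {κ R B : ℝ≥0}

theorem measurable_error (κ R ε : ℝ≥0) : Measurable fun b : W => (((Metric.closedBall (0 : W)
    (2 * R)).indicator (fun _ => κ * ε * (2 * R)) b : ℝ≥0) : ℝ≥0∞) :=
  (measurable_const.indicator Metric.isClosed_closedBall.measurableSet).coe_nnreal_ennreal

theorem setLIntegral_error (P : Set W) : ∫⁻ b in P, (((Metric.closedBall (0 : W)
    (2 * R)).indicator (fun _ => κ * ε * (2 * R)) b : ℝ≥0) : ℝ≥0∞) ∂μH[(n : ℝ)] =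
      ε * (κ * (2 * R) * μH[(n : ℝ)] (Metric.closedBall 0 (2 * R) ∩ P)) := by
  simp_rw [ENNReal.coe_indicator]
  rw [lintegral_indicator_const Metric.isClosed_closedBall.measurableSet,
    Measure.restrict_apply Metric.isClosed_closedBall.measurableSet]
  push_cast
  ring

/-- The part of `M` missed by `F '' E` costs at most `B` times its measure in the ball of radius `R
l`. On `F '' E`, changing measure costs `(1 + 2ε)ⁿ` and replacing `F` by `T` inside `φ` costs the
indicator error. -/
theorem setLIntegral_blowup_le (h : IsTangentPiece n M F T u ε E) (hε : ε ≤ 1 / 2)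
    (hF : Measurable F) (hT : MeasurableEmbedding T) (hφ : LipschitzWith κ φ)
    (hR : ∀ y, (R : ℝ) < ‖y‖ → φ y = 0) (hB : ∀ y, φ y ≤ B) {l : ℝ} (hl : 0 < l) :
    ∫⁻ y in M, φ (l⁻¹ • (y - F u)) ∂μH[(n : ℝ)] ≤
      B * μH[(n : ℝ)] ((M ∩ Metric.closedBall (F u) (R * l)) \ F '' E) +
      (1 + 2 * ε) ^ n * (ENNReal.ofReal (l ^ n) *
        (∫⁻ y in (LinearMap.range (T : V →ₗ[ℝ] W) : Set W), φ y ∂μH[(n : ℝ)] +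
        ε * (κ * (2 * R) * μH[(n : ℝ)] (Metric.closedBall 0 (2 * R) ∩
          (LinearMap.range (T : V →ₗ[ℝ] W) : Set W))))) := by
  have hφm : Measurable fun y => (φ y : ℝ≥0∞) := hφ.continuous.measurable.coe_nnreal_ennreal
  have hφl : Measurable fun y => (φ (l⁻¹ • (y - F u)) : ℝ≥0∞) :=
    hφm.comp (by fun_prop : Measurable fun y : W => l⁻¹ • (y - F u))
  have hsub : M ⊆ (M \ F '' E) ∪ F '' E := by
    rw [sdiff_union_self]; exact subset_union_left
  refine (lintegral_mono_set hsub).trans ((lintegral_union_le _ _ _).trans (add_le_add ?_ ?_))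
  · have : ∀ y, (φ (l⁻¹ • (y - F u)) : ℝ≥0∞) ≤
        (Metric.closedBall (F u) (R * l)).indicator (fun _ => (B : ℝ≥0∞)) y := by
      intro y
      by_cases hy : y ∈ Metric.closedBall (F u) (R * l)
      · rw [indicator_of_mem hy]; exact_mod_cast hB _
      · rw [indicator_of_notMem hy, hR _ ?_, ENNReal.coe_zero]
        rw [Metric.mem_closedBall, not_le, dist_eq_norm] at hy
        rw [norm_smul, Real.norm_of_nonneg (inv_nonneg.2 hl.le)]
        rwa [← div_eq_inv_mul, lt_div_iff₀ hl]
    refine (lintegral_mono this).trans ?_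
    rw [lintegral_indicator_const Metric.isClosed_closedBall.measurableSet,
      Measure.restrict_apply Metric.isClosed_closedBall.measurableSet]
    refine mul_le_mul_right (measure_mono ?_) _
    rintro y ⟨h1, h2, h3⟩
    exact ⟨⟨h2, h1⟩, h3⟩
  · refine (h.setLIntegral_image_le hF hT hφl).trans ?_
    gcongr
    have herr := measurable_error (W := W) κ R ε
    rw [← setLIntegral_error, ← lintegral_add_left hφm]
    refine le_trans ?_ (lintegral_comap_blowup hT u hl (hφm.add herr)).le
    refine le_trans ?_ (setLIntegral_le_lintegral E _)
    refine setLIntegral_mono' h.measurableSet fun w hw => ?_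
    simp only [Pi.add_apply]
    exact_mod_cast (hφ.le_add_indicator_closedBall hR hε (h.norm_blowup_sub_le hw l)).1

/-- The reverse estimate splits the parameter space into `E` and its complement. The antilipschitz
constant of `T` confines the support of the rescaled `φ` to the ball of radius `c R l` about `u`. -/
theorem le_setLIntegral_blowup (h : IsTangentPiece n M F T u ε E) (hε : ε ≤ 1 / 2)
    (hF : Measurable F) (hT : MeasurableEmbedding T) {c : ℝ≥0} (hc : AntilipschitzWith c T)
    (hφ : LipschitzWith κ φ)
    (hR : ∀ y, (R : ℝ) < ‖y‖ → φ y = 0) (hB : ∀ y, φ y ≤ B) {l : ℝ} (hl : 0 < l) :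
    ENNReal.ofReal (l ^ n) *
        ∫⁻ y in (LinearMap.range (T : V →ₗ[ℝ] W) : Set W), φ y ∂μH[(n : ℝ)] ≤
      B * (‖T‖₊ ^ n * μH[(n : ℝ)] (Metric.closedBall u (c * R * l) \ E)) +
      (1 + 2 * ε) ^ n * ∫⁻ y in M, φ (l⁻¹ • (y - F u)) ∂μH[(n : ℝ)] +
      ENNReal.ofReal (l ^ n) *
        (ε * (κ * (2 * R) * μH[(n : ℝ)] (Metric.closedBall 0 (2 * R) ∩
          (LinearMap.range (T : V →ₗ[ℝ] W) : Set W)))) := by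
  have hφm : Measurable fun y => (φ y : ℝ≥0∞) := hφ.continuous.measurable.coe_nnreal_ennreal
  have hφl : Measurable fun y => (φ (l⁻¹ • (y - F u)) : ℝ≥0∞) :=
    hφm.comp (by fun_prop : Measurable fun y : W => l⁻¹ • (y - F u))
  have herr := measurable_error (W := W) κ R ε
  rw [← lintegral_comap_blowup hT u hl hφm, ← lintegral_add_compl _ h.measurableSet, add_comm,
    add_assoc]
  refine add_le_add ?_ ?_
  · have : ∀ w, (φ (l⁻¹ • (T w - T u)) : ℝ≥0∞) ≤
        (Metric.closedBall u (c * R * l)).indicator (fun _ => (B : ℝ≥0∞)) w := by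
      intro w
      by_cases hw : w ∈ Metric.closedBall u (c * R * l)
      · rw [indicator_of_mem hw]; exact_mod_cast hB _
      · rw [indicator_of_notMem hw, hR _ ?_, ENNReal.coe_zero]
        rw [Metric.mem_closedBall, not_le] at hw
        have h2 := hw.trans_le (hc.le_mul_dist w u)
        rw [dist_eq_norm, mul_assoc] at h2
        rw [norm_smul, Real.norm_of_nonneg (inv_nonneg.2 hl.le), ← div_eq_inv_mul, lt_div_iff₀ hl]
        exact lt_of_mul_lt_mul_left h2 c.2
    refine (lintegral_mono this).trans ?_
    rw [lintegral_indicator_const Metric.isClosed_closedBall.measurableSet,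
      Measure.restrict_apply Metric.isClosed_closedBall.measurableSet, hT.comap_apply]
    gcongr
    have := T.lipschitz.hausdorffMeasure_image_le (d := n) (Nat.cast_nonneg n)
      (Metric.closedBall u (c * R * l) \ E)
    rwa [ENNReal.rpow_natCast] at this
  · rw [← setLIntegral_error, ← lintegral_comap_blowup hT u hl herr]
    have h1 : ∫⁻ w in E, φ (l⁻¹ • (T w - T u)) ∂(μH[(n : ℝ)] : Measure W).comap T ≤
        ∫⁻ w in E, (φ (l⁻¹ • (F w - F u)) : ℝ≥0∞) + (((Metric.closedBall (0 : W)
          (2 * R)).indicator (fun _ => κ * ε * (2 * R)) (l⁻¹ • (T w - T u)) : ℝ≥0) : ℝ≥0∞)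
          ∂(μH[(n : ℝ)] : Measure W).comap T := by
      refine setLIntegral_mono' h.measurableSet fun w hw => ?_
      exact_mod_cast (hφ.le_add_indicator_closedBall hR hε (h.norm_blowup_sub_le hw l)).2
    refine h1.trans ?_
    have hφF : Measurable fun w => (φ (l⁻¹ • (F w - F u)) : ℝ≥0∞) := hφl.comp hF
    rw [lintegral_add_left hφF]
    refine add_le_add ?_ (setLIntegral_le_lintegral E _)
    refine (h.le_setLIntegral_image hε hF hT hφl).trans ?_
    gcongr
    exact h.image_subset

end IsTangentPiece

end Blowup

theorem tendsto_density_comp_mul {m : ℝ → ℝ≥0∞} {n : ℕ}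
    (h : Tendsto (fun r => m r / ENNReal.ofReal (r ^ n)) (𝓝[>] 0) (𝓝 0)) {a : ℝ} (ha : 0 < a) :
    Tendsto (fun l => m (a * l) / ENNReal.ofReal (l ^ n)) (𝓝[>] 0) (𝓝 0) := by
  have h1 : Tendsto (fun l : ℝ => a * l) (𝓝[>] 0) (𝓝[>] 0) := by
    refine tendsto_nhdsWithin_iff.2 ⟨?_, ?_⟩
    · have : Tendsto (fun l : ℝ => a * l) (𝓝 0) (𝓝 (a * 0)) := tendsto_id.const_mul a
      rw [mul_zero] at this
      exact this.mono_left nhdsWithin_le_nhds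
    · filter_upwards [self_mem_nhdsWithin] with l hl using mul_pos ha hl
  have h2 := ENNReal.Tendsto.const_mul (a := ENNReal.ofReal (a ^ n)) (h.comp h1)
    (Or.inr ENNReal.ofReal_ne_top)
  rw [mul_zero] at h2
  refine h2.congr' ?_
  filter_upwards [self_mem_nhdsWithin] with l hl
  have hl : 0 < l := hl
  have han : ENNReal.ofReal (a ^ n) ≠ 0 := (ENNReal.ofReal_pos.2 (pow_pos ha n)).ne'
  rw [Function.comp, mul_pow, ENNReal.ofReal_mul (pow_pos ha n).le, ← mul_div_assoc,
    ENNReal.mul_div_mul_left _ _ han ENNReal.ofReal_ne_top]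

/-! ### The range of the derivative as approximate tangent space -/

section Tangent

variable {V W : Type*} [NormedAddCommGroup V] [NormedSpace ℝ V] [FiniteDimensional ℝ V]
    [MeasurableSpace V] [BorelSpace V]
    [NormedAddCommGroup W] [NormedSpace ℝ W] [MeasurableSpace W] [BorelSpace W]
    {n : ℕ} {M : Set W} {F : V → W} {T : V →L[ℝ] W} {u : V}

theorem hausdorffMeasure_closedBall_lt_top (hV : Module.finrank ℝ V = n) (u : V) (r : ℝ) :
    μH[(n : ℝ)] (Metric.closedBall u r) < ∞ := by
  subst hV
  have := FiniteDimensional.proper_real V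
  exact (isCompact_closedBall u r).measure_lt_top

theorem hausdorffMeasure_closedBall_inter_range_lt_top (hV : Module.finrank ℝ V = n)
    {c : ℝ≥0} (hc : AntilipschitzWith c T) (r : ℝ) :
    μH[(n : ℝ)] (Metric.closedBall 0 r ∩ (LinearMap.range (T : V →ₗ[ℝ] W) : Set W)) < ∞ := by
  have hsub : Metric.closedBall 0 r ∩ (LinearMap.range (T : V →ₗ[ℝ] W) : Set W) ⊆
      T '' Metric.closedBall 0 (c * r) := by
    rintro _ ⟨h1, v, rfl⟩
    refine ⟨v, ?_, rfl⟩
    have h2 := hc.le_mul_dist v 0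
    rw [map_zero] at h2
    exact h2.trans (mul_le_mul_of_nonneg_left h1 c.2)
  refine (measure_mono hsub).trans_lt
    ((T.lipschitz.hausdorffMeasure_image_le (d := n) (Nat.cast_nonneg n) _).trans_lt ?_)
  rw [ENNReal.rpow_natCast]
  exact ENNReal.mul_lt_top (by finiteness) (hausdorffMeasure_closedBall_lt_top hV _ _)

theorem setLIntegral_range_lt_top (hV : Module.finrank ℝ V = n)
    {c : ℝ≥0} (hc : AntilipschitzWith c T) {φ : W → ℝ≥0} {R B : ℝ≥0}
    (hR : ∀ y, (R : ℝ) < ‖y‖ → φ y = 0) (hB : ∀ y, φ y ≤ B) :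
    ∫⁻ y in (LinearMap.range (T : V →ₗ[ℝ] W) : Set W), φ y ∂μH[(n : ℝ)] < ∞ := by
  have : ∀ y, (φ y : ℝ≥0∞) ≤ (Metric.closedBall 0 R).indicator (fun _ => (B : ℝ≥0∞)) y := by
    intro y
    by_cases hy : y ∈ Metric.closedBall (0 : W) R
    · rw [indicator_of_mem hy]; exact_mod_cast hB _
    · rw [indicator_of_notMem hy, hR _ ?_, ENNReal.coe_zero]
      simpa using hy
  refine (lintegral_mono this).trans_lt ?_
  rw [lintegral_indicator_const Metric.isClosed_closedBall.measurableSet,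
      Measure.restrict_apply Metric.isClosed_closedBall.measurableSet]
  exact ENNReal.mul_lt_top ENNReal.coe_lt_top
    (hausdorffMeasure_closedBall_inter_range_lt_top hV hc _)

theorem tendsto_setLIntegral_blowup (hV : Module.finrank ℝ V = n) (hF : Measurable F)
    (hT : Function.Injective T) {ε : ℕ → ℝ≥0} (hε : Tendsto ε atTop (𝓝 0))
    (hε0 : ∀ k, 0 < ε k) (hε2 : ∀ k, ε k ≤ 1 / 2)
    (hE : ∀ k, ∃ E, IsTangentPiece n M F T u (ε k) E)
    {φ : W → ℝ≥0} {κ R B : ℝ≥0} (hφ : LipschitzWith κ φ)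
    (hR : ∀ y, (R : ℝ) < ‖y‖ → φ y = 0) (hB : ∀ y, φ y ≤ B) (hR0 : 0 < R) :
    Tendsto (fun l : ℝ => (ENNReal.ofReal (l ^ n))⁻¹ *
        ∫⁻ y in M, φ (l⁻¹ • (y - F u)) ∂μH[(n : ℝ)])
      (𝓝[>] 0) (𝓝 (∫⁻ y in (LinearMap.range (T : V →ₗ[ℝ] W) : Set W), φ y ∂μH[(n : ℝ)])) := by
  obtain ⟨c, hc0, hc⟩ := LinearMap.exists_antilipschitzWith (T : V →ₗ[ℝ] W)
    (LinearMap.ker_eq_bot.2 hT)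
  replace hc : AntilipschitzWith c T := hc
  have hTm : MeasurableEmbedding T :=
    (LinearMap.isClosedEmbedding_of_injective (f := (T : V →ₗ[ℝ] W))
      (LinearMap.ker_eq_bot.2 hT)).measurableEmbedding
  have hQ : κ * (2 * R) * μH[(n : ℝ)] (Metric.closedBall 0 (2 * R) ∩
          (LinearMap.range (T : V →ₗ[ℝ] W) : Set W)) ≠ ∞ :=
    ENNReal.mul_ne_top (by finiteness)
      (hausdorffMeasure_closedBall_inter_range_lt_top hV hc _).ne
  refine ENNReal.tendsto_of_forall_approx (setLIntegral_range_lt_top hV hc hR hB).ne hQ n hε ?_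
  -- The piece is fixed and `l → 0`: both density defects drop below `ε k`. Only afterwards does `k
  -- → ∞`.
  intro k
  obtain ⟨E, hEk⟩ := hE k
  have hd1 := ENNReal.Tendsto.const_mul (a := (B : ℝ≥0∞))
    (tendsto_density_comp_mul hEk.density_image (NNReal.coe_pos.2 hR0))
    (Or.inr ENNReal.coe_ne_top)
  have hd2 := ENNReal.Tendsto.const_mul (a := (B * ‖T‖₊ ^ n : ℝ≥0∞))
    (tendsto_density_comp_mul hEk.density (mul_pos (NNReal.coe_pos.2 hc0) (NNReal.coe_pos.2 hR0)))
    (Or.inr (by finiteness))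
  rw [mul_zero] at hd1 hd2
  have hpos : (0 : ℝ≥0∞) < ε k := by exact_mod_cast hε0 k
  filter_upwards [self_mem_nhdsWithin, hd1.eventually (gt_mem_nhds hpos),
    hd2.eventually (gt_mem_nhds hpos)] with l hl h1 h2
  have hl : 0 < l := hl
  have hln : ENNReal.ofReal (l ^ n) ≠ 0 := (ENNReal.ofReal_pos.2 (pow_pos hl n)).ne'
  have hln' : ENNReal.ofReal (l ^ n) ≠ ∞ := ENNReal.ofReal_ne_top
  constructor
  · refine (mul_le_mul_right (hEk.setLIntegral_blowup_le (hε2 k) hF hTm hφ hR hB hl) _).trans ?_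
    rw [mul_add]
    refine add_le_add (le_trans (le_of_eq ?_) h1.le) (le_of_eq ?_)
    · rw [ENNReal.div_eq_inv_mul]; ring
    · rw [mul_left_comm, ← mul_assoc (ENNReal.ofReal (l ^ n))⁻¹, ENNReal.inv_mul_cancel hln hln',
        one_mul]
  · have h3 := mul_le_mul_right (hEk.le_setLIntegral_blowup (hε2 k) hF hTm hc hφ hR hB hl)
      (ENNReal.ofReal (l ^ n))⁻¹
    rw [← mul_assoc, ENNReal.inv_mul_cancel hln hln', one_mul] at h3
    refine h3.trans ?_
    rw [mul_add, mul_add]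
    refine add_le_add (add_le_add (le_trans (le_of_eq ?_) h2.le) (le_of_eq ?_)) (le_of_eq ?_)
    · rw [ENNReal.div_eq_inv_mul]; ring
    · ring
    · rw [← mul_assoc, ENNReal.inv_mul_cancel hln hln', one_mul]

theorem tendsto_integral_blowup [FiniteDimensional ℝ W]
    (hV : Module.finrank ℝ V = n) (hF : Measurable F)
    (hT : Function.Injective T) {ε : ℕ → ℝ≥0} (hε : Tendsto ε atTop (𝓝 0)) (hε0 : ∀ k, 0 < ε k)
    (hε2 : ∀ k, ε k ≤ 1 / 2) (hE : ∀ k, ∃ E, IsTangentPiece n M F T u (ε k) E)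
    (hM : IsLocallyFiniteMeasure ((μH[(n : ℝ)] : Measure W).restrict M))
    {φ : W → ℝ} (hφ : ContDiff ℝ 1 φ) (hφc : HasCompactSupport φ) :
    Tendsto (fun l : ℝ => (l ^ n)⁻¹ * ∫ y in M, φ (l⁻¹ • (y - F u)) ∂μH[(n : ℝ)])
      (𝓝[>] 0) (𝓝 (∫ y in (LinearMap.range (T : V →ₗ[ℝ] W) : Set W), φ y ∂μH[(n : ℝ)])) := by
  obtain ⟨κ, hκ⟩ := ContDiff.lipschitzWith_of_hasCompactSupport hφc hφ one_ne_zero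
  obtain ⟨R, hR0, hR⟩ := hφc.exists_pos_le_norm
  obtain ⟨B, hB⟩ := hφc.exists_bound_of_continuous hφ.continuous
  -- Applied to `φ` and `-φ`, this handles the positive and negative parts, which are Lipschitz
  -- though no longer `C¹`.
  have hlim : ∀ ψ : W → ℝ, LipschitzWith κ ψ → (∀ y, R ≤ ‖y‖ → ψ y = 0) → (∀ y, ‖ψ y‖ ≤ B) →
      Tendsto (fun l : ℝ => (l ^ n)⁻¹ *
          (∫⁻ y in M, ENNReal.ofReal (ψ (l⁻¹ • (y - F u))) ∂μH[(n : ℝ)]).toReal)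
        (𝓝[>] 0) (𝓝 (∫⁻ y in (LinearMap.range (T : V →ₗ[ℝ] W) : Set W),
          ENNReal.ofReal (ψ y) ∂μH[(n : ℝ)]).toReal) := by
    intro ψ hψ hψR hψB
    have hR' : ∀ y, (R.toNNReal : ℝ) < ‖y‖ → (ψ y).toNNReal = 0 := by
      intro y hy
      rw [Real.coe_toNNReal _ hR0.le] at hy
      rw [hψR y hy.le, Real.toNNReal_zero]
    have hB' : ∀ y, (ψ y).toNNReal ≤ B.toNNReal := fun y =>
      Real.toNNReal_le_toNNReal ((le_abs_self _).trans (hψB y))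
    obtain ⟨c, hc0, hc⟩ := LinearMap.exists_antilipschitzWith (T : V →ₗ[ℝ] W)
      (LinearMap.ker_eq_bot.2 hT)
    have hfin := (setLIntegral_range_lt_top (T := T) hV hc hR' hB').ne
    have := (ENNReal.tendsto_toReal hfin).comp (tendsto_setLIntegral_blowup hV hF hT hε hε0 hε2 hE
      (Real.lipschitzWith_toNNReal.comp hψ) hR' hB' (Real.toNNReal_pos.2 hR0))
    refine this.congr' ?_
    filter_upwards [self_mem_nhdsWithin] with l hl
    have hl : 0 < l := hl
    rw [Function.comp, ENNReal.toReal_mul, ENNReal.toReal_inv,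
      ENNReal.toReal_ofReal (pow_pos hl n).le]
    rfl
  have hP : IsFiniteMeasureOnCompacts ((μH[(n : ℝ)] : Measure W).restrict
      (LinearMap.range (T : V →ₗ[ℝ] W) : Set W)) := by
    refine ⟨fun K hK => ?_⟩
    obtain ⟨c, hc0, hc⟩ := LinearMap.exists_antilipschitzWith (T : V →ₗ[ℝ] W)
      (LinearMap.ker_eq_bot.2 hT)
    obtain ⟨r, hr⟩ := hK.isBounded.subset_closedBall 0
    rw [Measure.restrict_apply hK.measurableSet]
    exact (measure_mono (inter_subset_inter_left _ hr)).trans_lt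
      (hausdorffMeasure_closedBall_inter_range_lt_top (T := T) hV hc r)
  rw [integral_eq_lintegral_pos_part_sub_lintegral_neg_part
    (hφ.continuous.integrable_of_hasCompactSupport hφc)]
  refine ((hlim φ hκ hR hB).sub (hlim (fun y => -φ y) hκ.neg (fun y hy => by simp [hR y hy])
    fun y => by simpa using hB y)).congr' ?_
  filter_upwards [self_mem_nhdsWithin] with l hl
  have hl : 0 < l := hl
  let e : W ≃ₜ W := (Homeomorph.subRight (F u)).trans
    (Homeomorph.smulOfNeZero l⁻¹ (inv_ne_zero hl.ne'))
  have hint : Integrable (fun y => φ (l⁻¹ • (y - F u))) ((μH[(n : ℝ)] : Measure W).restrict M) :=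
    (hφ.continuous.comp e.continuous).integrable_of_hasCompactSupport (hφc.comp_homeomorph e)
  rw [integral_eq_lintegral_pos_part_sub_lintegral_neg_part hint, mul_sub]

end Tangent

/-! ### Countable covers by almost linear pieces -/

section Pieces

variable {V W : Type*} [NormedAddCommGroup V] [NormedSpace ℝ V] [FiniteDimensional ℝ V]
    [NormedAddCommGroup W] [NormedSpace ℝ W] [FiniteDimensional ℝ W]

theorem exists_radius_of_injective {A : V →L[ℝ] W} (hA : Function.Injective A) {ε : ℝ}
    (hε : 0 < ε) : ∃ r : ℝ≥0, 0 < r ∧ ∀ T : V →L[ℝ] W, ‖T - A‖ < r →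
      ∀ h, 3 * r * ‖h‖ ≤ ε * ‖T h‖ := by
  obtain ⟨c, hc0, hc⟩ := LinearMap.exists_antilipschitzWith (A : V →ₗ[ℝ] W)
    (LinearMap.ker_eq_bot.2 hA)
  have hc0' : (0 : ℝ) < c := hc0
  -- This radius solves `3 r = ε (1/c - r)`, where `1/c - r` bounds `T` from below.
  have hr : 0 < ε / (c * (3 + ε)) := by positivity
  refine ⟨⟨ε / (c * (3 + ε)), hr.le⟩, hr, fun T hT h => ?_⟩
  have h1 : ‖h‖ ≤ c * ‖A h‖ := by simpa using hc.le_mul_dist h 0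
  have h2 : ‖A h‖ - ‖T h‖ ≤ ‖T - A‖ * ‖h‖ := by
    refine (norm_sub_norm_le _ _).trans ?_
    rw [norm_sub_rev]
    exact (T - A).le_opNorm h
  have h3 : ‖T - A‖ * ‖h‖ ≤ ε / (c * (3 + ε)) * ‖h‖ := by gcongr; exact hT.le
  have h4 : ‖h‖ / c ≤ ‖A h‖ := by rwa [div_le_iff₀' hc0']
  have h5 : 3 * (ε / (c * (3 + ε))) * ‖h‖ = ε * (‖h‖ / c - ε / (c * (3 + ε)) * ‖h‖) := by
    field_simp
    ring
  calc _ = ε * (‖h‖ / c - ε / (c * (3 + ε)) * ‖h‖) := h5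
    _ ≤ _ := by gcongr; linarith

variable [MeasurableSpace V] [BorelSpace V]

/-- The admissible radius depends on the lower bound of the derivative, so the injective maps are
first covered by countably many balls. Inside one ball the error is at most `3 r ‖p - q‖`: one `r`
from the approximation by `A'`, two from `A'` and `fderiv ℝ F u` both lying within `r` of the
centre. -/
theorem exists_countable_cover_norm_sub_le {F : V → W} {E : Set V} (hE : MeasurableSet E)
    (hd : ∀ u ∈ E, DifferentiableAt ℝ F u) (hinj : ∀ u ∈ E, Function.Injective (fderiv ℝ F u))
    {ε : ℝ} (hε : 0 < ε) : ∃ 𝒟 : Set (Set V), 𝒟.Countable ∧ E ⊆ ⋃₀ 𝒟 ∧ ∀ D ∈ 𝒟,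
      MeasurableSet D ∧ D ⊆ E ∧ ∀ u ∈ D, ∀ p ∈ D, ∀ q ∈ D,
        ‖F p - F q - fderiv ℝ F u (p - q)‖ ≤ ε * ‖fderiv ℝ F u (p - q)‖ := by
  have hex : ∀ A : V →L[ℝ] W, ∃ r : ℝ≥0, 0 < r ∧ (Function.Injective A →
      ∀ T : V →L[ℝ] W, ‖T - A‖ < r → ∀ h, 3 * r * ‖h‖ ≤ ε * ‖T h‖) := by
    intro A
    by_cases hA : Function.Injective A
    · obtain ⟨r, hr, h⟩ := exists_radius_of_injective hA hε
      exact ⟨r, hr, fun _ => h⟩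
    · exact ⟨1, one_pos, fun h => absurd h hA⟩
  choose r hr0 hr using hex
  obtain ⟨S, hSinj, hSc, hS⟩ := TopologicalSpace.countable_cover_nhdsWithin
    (s := {A : V →L[ℝ] W | Function.Injective A}) (f := fun A => Metric.ball A (r A))
    fun A _ => mem_nhdsWithin_of_mem_nhds (Metric.ball_mem_nhds A (hr0 A))
  have hpart : ∀ A : V →L[ℝ] W, ∃ t : ℕ → Set V, (∀ j, MeasurableSet (t j)) ∧
      (E ∩ fderiv ℝ F ⁻¹' Metric.ball A (r A)) ⊆ ⋃ j, t j ∧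
      ∀ j, ∃ A', ‖A' - A‖ ≤ r A ∧ ApproximatesLinearOn F A'
        ((E ∩ fderiv ℝ F ⁻¹' Metric.ball A (r A)) ∩ t j) (r A) := by
    intro A
    rcases (E ∩ fderiv ℝ F ⁻¹' Metric.ball A (r A)).eq_empty_or_nonempty with h0 | h0
    · refine ⟨fun _ => ∅, fun _ => MeasurableSet.empty, by simp [h0], fun j => ⟨A, by simp, ?_⟩⟩
      simp [ApproximatesLinearOn]
    · obtain ⟨t, A', -, htm, htc, hta, hty⟩ :=
        exists_partition_approximatesLinearOn_of_hasFDerivWithinAt F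
          (E ∩ fderiv ℝ F ⁻¹' Metric.ball A (r A)) (fderiv ℝ F)
          (fun u hu => (hd u hu.1).hasFDerivAt.hasFDerivWithinAt) (fun _ => r A)
          (fun _ => (hr0 A).ne')
      refine ⟨t, htm, htc, fun j => ⟨A' j, ?_, hta j⟩⟩
      obtain ⟨y, hy, hyA⟩ := hty h0 j
      rw [hyA, ← dist_eq_norm]
      exact (Metric.mem_ball.1 hy.2).le
  choose t htm htc hta using hpart
  refine ⟨⋃ A ∈ S, range fun j => E ∩ fderiv ℝ F ⁻¹' Metric.ball A (r A) ∩ t A j,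
    hSc.biUnion fun A _ => countable_range _, fun u hu => ?_, fun D hD => ?_⟩
  · obtain ⟨A, hA, huA⟩ := mem_iUnion₂.1 (hS (hinj u hu))
    obtain ⟨j, hj⟩ := mem_iUnion.1 (htc A ⟨hu, huA⟩)
    exact ⟨_, mem_iUnion₂.2 ⟨A, hA, j, rfl⟩, ⟨hu, huA⟩, hj⟩
  · obtain ⟨A, hA, j, rfl⟩ := mem_iUnion₂.1 hD
    refine ⟨(hE.inter (measurable_fderiv ℝ F Metric.isOpen_ball.measurableSet)).inter (htm A j),
      fun u hu => hu.1.1, fun u hu p hp q hq => ?_⟩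
    obtain ⟨A', hA', happ⟩ := hta A j
    have h1 : ‖fderiv ℝ F u - A‖ < r A := by
      rw [← dist_eq_norm]; exact hu.1.2
    refine le_trans ?_ (hr A (hSinj hA) _ h1 (p - q))
    have h2 := happ p hp q hq
    have h3 : ‖(A' - fderiv ℝ F u) (p - q)‖ ≤ (r A + r A) * ‖p - q‖ := by
      refine (ContinuousLinearMap.le_opNorm _ _).trans ?_
      gcongr
      rw [← sub_sub_sub_cancel_right _ _ A]
      exact (norm_sub_le _ _).trans (add_le_add hA' h1.le)
    have h4 : F p - F q - fderiv ℝ F u (p - q) =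
        (F p - F q - A' (p - q)) + (A' - fderiv ℝ F u) (p - q) := by
      simp
    rw [h4]
    refine (norm_add_le _ _).trans ?_
    linarith

end Pieces

/-! ### Critical values are negligible -/

section Sard

variable {V W : Type*} [NormedAddCommGroup V] [NormedSpace ℝ V] [FiniteDimensional ℝ V]
    [MeasurableSpace V] [BorelSpace V]
    [NormedAddCommGroup W] [NormedSpace ℝ W] [FiniteDimensional ℝ W]
    [MeasurableSpace W] [BorelSpace W]

/-- `B` shrinks a unit kernel vector `k` of `A` by the factor `ε` and fixes the kernel of a norming
functional `f` of `k`. A map `ε`-close to `A` is then Lipschitz relative to `B`, whose images have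
volume scaled by `ε`. -/
theorem exists_det_eq_and_norm_le {A : V →L[ℝ] W} (hA : ¬ Function.Injective A) {L : ℝ}
    (hL : ‖A‖ ≤ L) {ε : ℝ} (hε : 0 < ε) (hε1 : ε ≤ 1) :
    ∃ B : V →ₗ[ℝ] V, LinearMap.det B = ε ∧ ∀ h, ‖A h‖ + ε * ‖h‖ ≤ (2 * L + 3) * ‖B h‖ := by
  obtain ⟨k₀, hk₀, hk₀0⟩ : ∃ k, A k = 0 ∧ k ≠ 0 := by
    by_contra! hcon
    exact hA ((injective_iff_map_eq_zero A).2 hcon)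
  obtain ⟨f, hf1, hf⟩ := exists_dual_vector ℝ k₀ (norm_ne_zero_iff.2 hk₀0)
  set k := ‖k₀‖⁻¹ • k₀ with hk
  have hAk : A k = 0 := by rw [hk, map_smul, hk₀, smul_zero]
  have hk1 : ‖k‖ = 1 := by
    rw [hk, norm_smul, norm_inv, norm_norm, inv_mul_cancel₀ (norm_ne_zero_iff.2 hk₀0)]
  have hfk : f k = 1 := by
    rw [hk, map_smul, hf, smul_eq_mul]
    exact inv_mul_cancel₀ (norm_ne_zero_iff.2 hk₀0)
  refine ⟨LinearMap.transvection (f : V →ₗ[ℝ] ℝ) ((ε - 1) • k), ?_, fun h => ?_⟩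
  · rw [LinearMap.transvection.det, map_smul]
    simp [hfk]
  · set b := LinearMap.transvection (f : V →ₗ[ℝ] ℝ) ((ε - 1) • k) h with hb
    have hb' : b = h + f h • ((ε - 1) • k) := rfl
    have h1 : f b = ε * f h := by
      rw [hb', map_add, map_smul, map_smul, hfk]; simp; ring
    have h2 : |ε * f h| ≤ ‖b‖ := by
      rw [← h1]
      simpa [hf1] using f.le_opNorm b
    have h3 : h = (b - (ε * f h) • k) + f h • k := by
      rw [hb']; module
    have h4 : ‖b - (ε * f h) • k‖ ≤ 2 * ‖b‖ := by
      refine (norm_sub_le _ _).trans ?_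
      rw [norm_smul, hk1, Real.norm_eq_abs]
      linarith
    have h5 : ‖A h‖ ≤ L * (2 * ‖b‖) := by
      have : A h = A (b - (ε * f h) • k) := by
        conv_lhs => rw [h3]
        rw [map_add, map_smul, hAk, smul_zero, add_zero]
      rw [this]
      refine (A.le_opNorm _).trans ?_
      gcongr
      exact (norm_nonneg _).trans hL
    have h6 : ε * ‖h‖ ≤ 3 * ‖b‖ := by
      have h7 : ‖h‖ ≤ 2 * ‖b‖ + |f h| := by
        conv_lhs => rw [h3]
        refine (norm_add_le _ _).trans ?_
        rw [norm_smul, hk1, Real.norm_eq_abs, mul_one]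
        gcongr
      rw [abs_mul, abs_of_pos hε] at h2
      nlinarith [norm_nonneg b]
    linarith

theorem hausdorffMeasure_image_le_of_approximatesLinearOn {n : ℕ}
    (hV : Module.finrank ℝ V = n) {F : V → W} {A : V →L[ℝ] W} (hA : ¬ Function.Injective A)
    {L ε : ℝ≥0} (hL : ‖A‖ ≤ L) (hε : 0 < ε) (hε1 : ε ≤ 1) {s : Set V}
    (h : ApproximatesLinearOn F A s ε) :
    μH[(n : ℝ)] (F '' s) ≤ (2 * L + 3) ^ n * (ε * μH[(n : ℝ)] s) := by
  obtain ⟨B, hBdet, hB⟩ := exists_det_eq_and_norm_le hA hL (NNReal.coe_pos.2 hε)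
    (by exact_mod_cast hε1)
  subst hV
  have h1 : μH[((Module.finrank ℝ V : ℕ) : ℝ)] (F '' s) ≤ ((2 * L + 3 : ℝ≥0) : ℝ≥0∞) ^
      Module.finrank ℝ V * μH[((Module.finrank ℝ V : ℕ) : ℝ)] (B '' s) := by
    refine hausdorffMeasure_image_le_of_edist_le _ fun p hp q hq => ?_
    rw [edist_nndist, edist_nndist]
    norm_cast
    rw [← NNReal.coe_le_coe]
    push_cast
    rw [dist_eq_norm, dist_eq_norm, ← map_sub]
    refine le_trans ?_ (hB (p - q))
    have h2 := norm_add_le (F p - F q - A (p - q)) (A (p - q))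
    rw [sub_add_cancel] at h2
    linarith [h p hp q hq]
  rw [Measure.addHaar_image_linearMap, hBdet] at h1
  simpa using h1

/-- On each cell of a partition, `F` is `ε`-close to its derivative at a critical point, so the
images have total measure `O(ε)` over a bounded region; then `ε → 0`. -/
theorem LipschitzWith.hausdorffMeasure_image_not_injective_eq_zero {n : ℕ}
    (hV : Module.finrank ℝ V = n) {F : V → W} {L : ℝ≥0} (hF : LipschitzWith L F) :
    μH[(n : ℝ)] (F '' {u | DifferentiableAt ℝ F u ∧ ¬ Function.Injective (fderiv ℝ F u)}) = 0 := by
  set s := {u | DifferentiableAt ℝ F u ∧ ¬ Function.Injective (fderiv ℝ F u)} with hs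
  have hball : ∀ R : ℕ, μH[(n : ℝ)] (F '' (s ∩ Metric.closedBall 0 R)) = 0 := by
    intro R
    have hfin := hausdorffMeasure_closedBall_lt_top hV (0 : V) R
    rcases (s ∩ Metric.closedBall 0 (R : ℝ)).eq_empty_or_nonempty with h0 | h0
    · rw [h0]; simp
    have hle : ∀ ε : ℝ≥0, 0 < ε → ε ≤ 1 → μH[(n : ℝ)] (F '' (s ∩ Metric.closedBall 0 R)) ≤
        (2 * L + 3) ^ n * (ε * μH[(n : ℝ)] (Metric.closedBall (0 : V) R)) := by
      intro ε hε hε1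
      obtain ⟨t, A, htd, htm, htc, hta, hty⟩ :=
        exists_partition_approximatesLinearOn_of_hasFDerivWithinAt F
          (s ∩ Metric.closedBall 0 (R : ℝ)) (fderiv ℝ F)
          (fun u hu => hu.1.1.hasFDerivAt.hasFDerivWithinAt) (fun _ => ε) (fun _ => hε.ne')
      have hsub : F '' (s ∩ Metric.closedBall 0 R) ⊆
          ⋃ j, F '' (s ∩ Metric.closedBall 0 R ∩ t j) := by
        rw [← image_iUnion, ← inter_iUnion]
        exact image_mono fun u hu => ⟨hu, htc hu⟩
      calc _ ≤ ∑' j, μH[(n : ℝ)] (F '' (s ∩ Metric.closedBall 0 R ∩ t j)) :=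
            (measure_mono hsub).trans (measure_iUnion_le _)
        _ ≤ ∑' j, (2 * L + 3) ^ n * (ε * μH[(n : ℝ)] (Metric.closedBall (0 : V) R ∩ t j)) := by
            refine ENNReal.tsum_le_tsum fun j => ?_
            obtain ⟨y, hy, hyA⟩ := hty h0 j
            refine (hausdorffMeasure_image_le_of_approximatesLinearOn hV (A := A j) (L := L) ?_ ?_
              hε hε1 (hta j)).trans ?_
            · rw [hyA]; exact hy.1.2
            · rw [hyA]; exact norm_fderiv_le_of_lipschitz ℝ hF
            · gcongr
              exact inter_subset_right
        _ = (2 * L + 3) ^ n * (ε * ∑' j, μH[(n : ℝ)] (Metric.closedBall (0 : V) R ∩ t j)) := by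
            rw [ENNReal.tsum_mul_left, ENNReal.tsum_mul_left]
        _ ≤ _ := by
            rw [← measure_iUnion (fun i j hij => (htd hij).mono inter_subset_right inter_subset_right)
              fun j => Metric.isClosed_closedBall.measurableSet.inter (htm j)]
            gcongr
            exact iUnion_subset fun j => inter_subset_left
    have hlim : Tendsto (fun ε : ℝ≥0 => (2 * L + 3 : ℝ≥0∞) ^ n *
        (ε * μH[(n : ℝ)] (Metric.closedBall (0 : V) R))) (𝓝[>] 0) (𝓝 0) := by
      have h1 : Tendsto (fun ε : ℝ≥0 => (ε : ℝ≥0∞)) (𝓝[>] 0) (𝓝 ((0 : ℝ≥0) : ℝ≥0∞)) :=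
        (ENNReal.tendsto_coe.2 tendsto_id).mono_left nhdsWithin_le_nhds
      have h2 := ENNReal.Tendsto.const_mul (a := (2 * L + 3 : ℝ≥0∞) ^ n)
        (ENNReal.Tendsto.mul_const h1 (Or.inr hfin.ne)) (Or.inr (by finiteness))
      simpa using h2
    refine le_antisymm (ge_of_tendsto hlim ?_) bot_le
    filter_upwards [self_mem_nhdsWithin, mem_nhdsWithin_of_mem_nhds (Iic_mem_nhds one_pos)]
      with ε h1 h2 using hle ε h1 h2
  have hunion : F '' s = ⋃ R : ℕ, F '' (s ∩ Metric.closedBall 0 R) := by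
    rw [← image_iUnion, ← inter_iUnion, Metric.iUnion_closedBall_nat, inter_univ]
  rw [hunion]
  exact measure_iUnion_null hball

end Sard

/-! ### Density points -/

/-- Besicovitch differentiation gives density relative to `μ` of the ball; the bound `C rⁿ` turns it
into density relative to `rⁿ`. -/
theorem ae_tendsto_density_compl {β : Type*} [NormedAddCommGroup β] [NormedSpace ℝ β]
    [FiniteDimensional ℝ β] [MeasurableSpace β] [BorelSpace β] (μ : Measure β)
    [IsLocallyFiniteMeasure μ] {S : Set β} (hS : MeasurableSet S) (n : ℕ)
    (hμ : ∀ᵐ x ∂μ, ∃ C : ℝ≥0∞, C ≠ ∞ ∧ ∀ᶠ r : ℝ in 𝓝[>] 0,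
      μ (Metric.closedBall x r) ≤ C * ENNReal.ofReal (r ^ n)) :
    ∀ᵐ x ∂μ, x ∈ S → Tendsto (fun r : ℝ => μ (Metric.closedBall x r \ S) /
      ENNReal.ofReal (r ^ n)) (𝓝[>] 0) (𝓝 0) := by
  have := FiniteDimensional.proper_real β
  filter_upwards [hμ, Besicovitch.ae_tendsto_measure_inter_div_of_measurableSet μ hS.compl]
    with x hx hd hxS
  obtain ⟨C, hC, hxC⟩ := hx
  rw [indicator_of_notMem (by simpa using hxS)] at hd
  have h1 := ENNReal.Tendsto.const_mul (a := C) hd (Or.inr hC)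
  rw [mul_zero] at h1
  refine tendsto_of_tendsto_of_tendsto_of_le_of_le' tendsto_const_nhds h1
    (Eventually.of_forall fun _ => bot_le) ?_
  filter_upwards [hxC, self_mem_nhdsWithin] with r hr hr0
  have hr0 : 0 < r := hr0
  have hρ : ENNReal.ofReal (r ^ n) ≠ 0 := (ENNReal.ofReal_pos.2 (pow_pos hr0 n)).ne'
  rw [sdiff_eq, inter_comm]
  rcases eq_or_ne (μ (Metric.closedBall x r)) 0 with h0 | h0
  · rw [measure_mono_null inter_subset_right h0]; simp
  have htop : μ (Metric.closedBall x r) ≠ ∞ :=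
    (hr.trans_lt (ENNReal.mul_lt_top hC.lt_top ENNReal.ofReal_lt_top)).ne
  rw [← mul_div_assoc, ENNReal.div_le_iff hρ ENNReal.ofReal_ne_top, mul_comm C, mul_div_assoc,
    mul_assoc, mul_comm (C / _), ← mul_div_assoc, mul_comm (ENNReal.ofReal _)]
  refine le_mul_of_one_le_right bot_le ?_
  rw [ENNReal.le_div_iff_mul_le (Or.inl h0) (Or.inl htop), one_mul]
  exact hr

/-! ### Differentiability along the tangent plane -/

section Differentiability

variable {V W : Type*} [NormedAddCommGroup V] [NormedSpace ℝ V]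
    [NormedAddCommGroup W] [NormedSpace ℝ W]

theorem LipschitzWith.hasFDerivAt_comp_affine {F : V → W} {T : V →L[ℝ] W} {u : V}
    (hF : HasFDerivAt F T u) {g : W → ℝ} {K : ℝ≥0} (hg : LipschitzWith K g) {L : V →L[ℝ] ℝ}
    (hL : HasFDerivAt (g ∘ F) L u) : HasFDerivAt (fun h : V => g (F u + T h)) L 0 := by
  rw [hasFDerivAt_iff_isLittleO_nhds_zero] at hF hL ⊢
  have h1 : (fun h : V => g (F u + T h) - g (F (u + h))) =o[𝓝 0] fun h => h := by
    refine Asymptotics.IsBigO.trans_isLittleO (Asymptotics.IsBigO.of_bound K ?_) hF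
    refine Eventually.of_forall fun h => ?_
    rw [← dist_eq_norm]
    refine (hg.dist_le_mul _ _).trans ?_
    rw [dist_eq_norm, norm_sub_rev, sub_sub]
  refine (h1.add hL).congr_left fun h => ?_
  simp only [Function.comp, zero_add, map_zero, add_zero]
  ring

theorem LipschitzWith.differentiableAt_range [FiniteDimensional ℝ V] {F : V → W}
    {T : V →L[ℝ] W} (hT : Function.Injective T) {u : V}
    (hF : HasFDerivAt F T u) {g : W → ℝ} {K : ℝ≥0} (hg : LipschitzWith K g)
    (hgF : DifferentiableAt ℝ (g ∘ F) u) :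
    DifferentiableAt ℝ (fun w : LinearMap.range (T : V →ₗ[ℝ] W) => g (F u + w)) 0 := by
  let e := (LinearEquiv.ofInjective (T : V →ₗ[ℝ] W) hT).toContinuousLinearEquiv
  have he : ∀ w, T (e.symm w) = w := fun w => by
    have := congrArg Subtype.val (e.apply_symm_apply w)
    exact this
  have h1 : DifferentiableAt ℝ (fun h : V => g (F u + T h)) (e.symm 0) := by
    rw [map_zero]
    exact (hg.hasFDerivAt_comp_affine hF hgF.hasFDerivAt).differentiableAt
  have h2 := h1.comp (0 : LinearMap.range (T : V →ₗ[ℝ] W)) e.symm.differentiableAt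
  refine h2.congr_of_eventuallyEq (Eventually.of_forall fun w => ?_)
  simp [he]

end Differentiability

/-! ### Bounding the gradient by the local Lipschitz constant -/

section GradientBound

variable {n : ℕ} {M : Set (EuclideanSpace ℝ (Fin (n + 1)))}
  {x : EuclideanSpace ℝ (Fin (n + 1))} {P : Submodule ℝ (EuclideanSpace ℝ (Fin (n + 1)))}

/-- A bump at `e` has positive integral over `P`, where `ℋⁿ` is a Haar measure. So its blow-up
integrals over `M` are eventually nonzero, and `M` must meet the rescaled support. -/
theorem IsApproxTangentSpace.eventually_exists_mem (hP : IsApproxTangentSpace n M x P)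
    {e : EuclideanSpace ℝ (Fin (n + 1))} (he : e ∈ P) {η : ℝ} (hη : 0 < η) :
    ∀ᶠ l : ℝ in 𝓝[>] 0, ∃ y ∈ M, ‖y - (x + l • e)‖ ≤ η * l := by
  let φ : ContDiffBump e := ⟨η / 2, η, by positivity, by linarith⟩
  have hlim := hP.2 φ φ.contDiff φ.hasCompactSupport
  have hpos : 0 < ∫ y in (P : Set (EuclideanSpace ℝ (Fin (n + 1)))), φ y ∂μH[(n : ℝ)] := by
    have hi : Isometry ((↑) : P → EuclideanSpace ℝ (Fin (n + 1))) := isometry_subtype_coe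
    have hemb : MeasurableEmbedding ((↑) : P → EuclideanSpace ℝ (Fin (n + 1))) :=
      MeasurableEmbedding.subtype_coe P.closed_of_finiteDimensional.measurableSet
    have hmap := hi.map_hausdorffMeasure (d := (n : ℝ)) (Or.inl (Nat.cast_nonneg n))
    rw [Subtype.range_coe] at hmap
    have hmap' : ((μH[(n : ℝ)] : Measure (EuclideanSpace ℝ (Fin (n + 1)))).restrict
        (P : Set (EuclideanSpace ℝ (Fin (n + 1))))) = Measure.map Subtype.val μH[(n : ℝ)] :=
      hmap.symm
    rw [hmap', hemb.integral_map]
    have hH : (μH[(n : ℝ)] : Measure P).IsAddHaarMeasure := by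
      rw [show (n : ℝ) = ((Module.finrank ℝ P : ℕ) : ℝ) by rw [hP.1]]; infer_instance
    refine Continuous.integral_pos_of_hasCompactSupport_nonneg_nonzero (x := ⟨e, he⟩)
      (φ.continuous.comp continuous_subtype_val) ?_ (fun _ => φ.nonneg) ?_
    · exact φ.hasCompactSupport.comp_isClosedEmbedding
        P.closed_of_finiteDimensional.isClosedEmbedding_subtypeVal
    · have : φ e = 1 := φ.one_of_mem_closedBall (Metric.mem_closedBall_self φ.rIn_pos.le)
      simp [this]
  filter_upwards [hlim.eventually (lt_mem_nhds hpos), self_mem_nhdsWithin] with l hl hl0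
  have hl0 : 0 < l := hl0
  by_contra! hcon
  refine hl.ne' ?_
  rw [setIntegral_eq_zero_of_forall_eq_zero, mul_zero]
  intro y hy
  by_contra hne
  have hmem : l⁻¹ • (y - x) ∈ Metric.ball e η := by
    have : l⁻¹ • (y - x) ∈ Function.support φ := hne
    rwa [φ.support_eq] at this
  refine absurd (hcon y hy) (not_lt.2 ?_)
  have h1 : y - (x + l • e) = l • (l⁻¹ • (y - x) - e) := by
    rw [smul_sub, smul_inv_smul₀ hl0.ne', sub_sub]
  rw [h1, norm_smul, Real.norm_of_nonneg hl0.le, mul_comm η]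
  gcongr
  rw [← dist_eq_norm]
  exact (Metric.mem_ball.1 hmem).le

theorem IsApproxTangentSpace.enorm_gradient_le_localLip (hP : IsApproxTangentSpace n M x P)
    (hx : x ∈ M) {f : M → ℝ} {g : EuclideanSpace ℝ (Fin (n + 1)) → ℝ} {K : ℝ≥0}
    (hg : LipschitzWith K g) (hgf : ∀ y : M, g y = f y) {v : P}
    (hv : HasGradientAt (fun w : P => g (x + w)) v 0) :
    ‖(v : EuclideanSpace ℝ (Fin (n + 1)))‖ₑ ≤ localLip f ⟨x, hx⟩ := by
  refine le_iInf₂ fun r hr => ?_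
  set S := ⨆ (y : M) (_ : y ∈ Metric.ball (⟨x, hx⟩ : M) r) (_ : y ≠ ⟨x, hx⟩),
    ENNReal.ofReal (|f y - f ⟨x, hx⟩| / dist y ⟨x, hx⟩) with hS
  rcases eq_or_ne S ∞ with htop | htop
  · rw [htop]; exact le_top
  have hle : ∀ y ∈ M, dist y x < r → |g y - g x| ≤ S.toReal * dist y x := by
    intro y hy hyr
    rcases eq_or_ne y x with rfl | hne
    · simp
    rw [← div_le_iff₀ (dist_pos.2 hne)]
    refine (ENNReal.ofReal_le_iff_le_toReal htop).1 ?_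
    have h1 : ENNReal.ofReal (|f ⟨y, hy⟩ - f ⟨x, hx⟩| / dist (⟨y, hy⟩ : M) ⟨x, hx⟩) ≤ S :=
      le_iSup₂_of_le (⟨y, hy⟩ : M) hyr (le_iSup_of_le (by simpa using hne) le_rfl)
    rwa [← hgf, ← hgf] at h1
  rw [← ofReal_norm, ENNReal.ofReal_le_iff_le_toReal htop]
  rcases eq_or_ne v 0 with rfl | hv0
  · simp
  have hvn : (0 : ℝ) < ‖v‖ := norm_pos_iff.2 hv0
  set e : P := ‖v‖⁻¹ • v with he
  have hen : ‖e‖ = 1 := by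
    rw [he, norm_smul, norm_inv, norm_norm, inv_mul_cancel₀ hvn.ne']
  have hve : inner ℝ v e = ‖v‖ := by
    have h1 : inner ℝ v (‖v‖⁻¹ • v) = ‖v‖⁻¹ * inner ℝ v v := inner_smul_right v v ‖v‖⁻¹
    rw [he, h1, real_inner_self_eq_norm_sq, sq, inv_mul_cancel_left₀ hvn.ne']
  -- The `η` errors come from the differential (`1`), from moving `x + l e` to a point `y` of `M`
  -- (`K`), and from `dist y x ≤ (1 + η) l` (`S`).
  have hkey : ∀ η : ℝ, 0 < η → ‖v‖ ≤ η * (1 + K + S.toReal) + S.toReal := by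
    intro η hη
    have hlo := (hasFDerivAt_iff_isLittleO_nhds_zero.1 hv.hasFDerivAt).bound hη
    have ht : Tendsto (fun l : ℝ => l • e) (𝓝[>] 0) (𝓝 0) := by
      have : Tendsto (fun l : ℝ => l • e) (𝓝 0) (𝓝 ((0 : ℝ) • e)) :=
        tendsto_id.smul_const e
      rw [zero_smul] at this
      exact this.mono_left nhdsWithin_le_nhds
    have hsmall : ∀ᶠ l : ℝ in 𝓝[>] 0, l < r / (1 + η) :=
      mem_nhdsWithin_of_mem_nhds (Iio_mem_nhds (by positivity))
    obtain ⟨l, h1, ⟨y, hyM, hy⟩, h2, hl⟩ := ((ht.eventually hlo).and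
      ((hP.eventually_exists_mem e.2 hη).and (hsmall.and self_mem_nhdsWithin))).exists
    have hl : 0 < l := hl
    rw [lt_div_iff₀ (by positivity)] at h2
    have hyx : dist y x ≤ (1 + η) * l := by
      rw [dist_eq_norm]
      have h3 : y - x = (y - (x + l • (e : EuclideanSpace ℝ (Fin (n + 1))))) +
          l • (e : EuclideanSpace ℝ (Fin (n + 1))) := by abel
      rw [h3]
      refine (norm_add_le _ _).trans ?_
      have h8 : ‖(e : EuclideanSpace ℝ (Fin (n + 1)))‖ = 1 := hen
      rw [norm_smul, Real.norm_of_nonneg hl.le, h8]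
      linarith
    have h4 := hle y hyM (by linarith)
    have h5 : S.toReal * dist y x ≤ S.toReal * ((1 + η) * l) := by gcongr
    have h6 : |g y - g (x + l • (e : EuclideanSpace ℝ (Fin (n + 1))))| ≤ K * (η * l) := by
      rw [← Real.dist_eq]
      refine (hg.dist_le_mul _ _).trans ?_
      rw [dist_eq_norm]
      gcongr
    have h7 : |g (x + l • (e : EuclideanSpace ℝ (Fin (n + 1)))) - g x - l * ‖v‖| ≤ η * l := by
      have h8 : ‖l • e‖ = l := by rw [norm_smul, hen, Real.norm_of_nonneg hl.le, mul_one]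
      rw [h8, map_smul, InnerProductSpace.toDual_apply_apply, hve] at h1
      simpa using h1
    have h9 : l * ‖v‖ ≤ l * (η * (1 + K + S.toReal) + S.toReal) := by
      have a1 := (abs_le.1 h4).2
      have a2 := (abs_le.1 h6).1
      have a3 := (abs_le.1 h7).1
      linarith
    exact le_of_mul_le_mul_left h9 hl
  refine le_of_tendsto_of_tendsto (f := fun _ : ℝ => ‖v‖)
    (g := fun η : ℝ => η * (1 + K + S.toReal) + S.toReal) (b := 𝓝[>] 0) tendsto_const_nhds ?_ ?_
  · have : Tendsto (fun η : ℝ => η * (1 + K + S.toReal) + S.toReal) (𝓝 0)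
        (𝓝 (0 * (1 + K + S.toReal) + S.toReal)) :=
      (tendsto_id.mul_const _).add_const _
    rw [zero_mul, zero_add] at this
    exact this.mono_left nhdsWithin_le_nhds
  · filter_upwards [self_mem_nhdsWithin] with η hη using hkey η hη

end GradientBound

/-! ### From almost every parameter to almost every point of `M` -/

theorem LipschitzWith.ae_hausdorffMeasure_forall_fiber {X Y : Type*} [EMetricSpace X]
    [MeasurableSpace X] [BorelSpace X] [EMetricSpace Y] [MeasurableSpace Y] [BorelSpace Y]
    {F : X → Y} {L : ℝ≥0} (hF : LipschitzWith L F) {d : ℝ} (hd : 0 ≤ d) {p : X → Prop}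
    (hp : ∀ᵐ u ∂(μH[d] : Measure X), p u) : ∀ᵐ y ∂(μH[d] : Measure Y), ∀ u, F u = y → p u := by
  rw [ae_iff] at hp ⊢
  refine measure_mono_null (t := F '' {u | ¬ p u}) ?_ ?_
  · intro y hy
    simp only [mem_ofPred_eq, not_forall] at hy
    obtain ⟨u, hu, hpu⟩ := hy
    exact ⟨u, hpu, hu⟩
  · refine le_antisymm ((hF.hausdorffMeasure_image_le hd _).trans ?_) bot_le
    rw [hp, mul_zero]

section Ahlfors

variable {n : ℕ} {M : Set (EuclideanSpace ℝ (Fin (n + 1)))}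

theorem IsAhlforsRegular.exists_eventually_closedBall_le (h : IsAhlforsRegular n M)
    {x : EuclideanSpace ℝ (Fin (n + 1))} (hx : x ∈ M) :
    ∃ C : ℝ≥0∞, C ≠ ∞ ∧ ∀ᶠ r : ℝ in 𝓝[>] 0,
      ((μH[(n : ℝ)] : Measure (EuclideanSpace ℝ (Fin (n + 1)))).restrict M)
        (Metric.closedBall x r) ≤ C * ENNReal.ofReal (r ^ n) := by
  obtain ⟨-, C, hC, hM⟩ := h
  refine ⟨ENNReal.ofReal (C * 2 ^ n), ENNReal.ofReal_ne_top, ?_⟩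
  filter_upwards [self_mem_nhdsWithin,
    mem_nhdsWithin_of_mem_nhds (Iio_mem_nhds (by norm_num : (0 : ℝ) < 1 / 2))] with r hr hr2
  have hr : 0 < r := hr
  have hr2 : r < 1 / 2 := hr2
  refine (measure_mono (Metric.closedBall_subset_ball (by linarith : r < 2 * r))).trans
    ((hM x hx (2 * r) (by linarith) (by linarith)).2.trans (le_of_eq ?_))
  rw [← ENNReal.ofReal_mul (by positivity), mul_pow, mul_assoc]

theorem IsAhlforsRegular.isLocallyFiniteMeasure (h : IsAhlforsRegular n M) :
    IsLocallyFiniteMeasure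
      ((μH[(n : ℝ)] : Measure (EuclideanSpace ℝ (Fin (n + 1)))).restrict M) := by
  refine ⟨fun x => ?_⟩
  by_cases hx : x ∈ M
  · obtain ⟨C, hC, hCx⟩ := h.exists_eventually_closedBall_le hx
    obtain ⟨r, hr, hr0⟩ := (hCx.and self_mem_nhdsWithin).exists
    exact ⟨_, Metric.closedBall_mem_nhds x hr0,
      hr.trans_lt (ENNReal.mul_lt_top hC.lt_top ENNReal.ofReal_lt_top)⟩
  · refine ⟨Mᶜ, h.1.isOpen_compl.mem_nhds hx, ?_⟩
    rw [Measure.restrict_apply h.1.isOpen_compl.measurableSet, compl_inter_self, measure_empty]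
    exact ENNReal.zero_lt_top

theorem IsAhlforsRegular.ae_isTangentPiece (h : IsAhlforsRegular n M) {V : Type*}
    [NormedAddCommGroup V] [NormedSpace ℝ V] [FiniteDimensional ℝ V] [MeasurableSpace V]
    [BorelSpace V] (hV : Module.finrank ℝ V = n) {F : V → EuclideanSpace ℝ (Fin (n + 1))}
    {L : ℝ≥0} (hF : LipschitzWith L F) {D : Set V} (hD : MeasurableSet D)
    (hDM : MapsTo F D M) (hinj : ∀ u ∈ D, Function.Injective (fderiv ℝ F u))
    {ε : ℝ≥0} (hε : ε < 1)
    (hle : ∀ u ∈ D, ∀ p ∈ D, ∀ q ∈ D,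
        ‖F p - F q - fderiv ℝ F u (p - q)‖ ≤ ε * ‖fderiv ℝ F u (p - q)‖) :
    ∀ᵐ y ∂(μH[(n : ℝ)] : Measure (EuclideanSpace ℝ (Fin (n + 1)))),
      ∀ u ∈ D, F u = y → IsTangentPiece n M F (fderiv ℝ F u) u ε D := by
  -- With relative error below one, `F p = F q` forces the derivative to kill `p - q`. Injectivity
  -- is what makes `F '' D` Borel.
  have hFD : InjOn F D := by
    intro p hp q hq hpq
    have h1 := hle p hp p hp q hq
    rw [hpq, sub_self, zero_sub, norm_neg] at h1
    have hε' : (ε : ℝ) < 1 := by exact_mod_cast hε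
    have h2 : ‖fderiv ℝ F p (p - q)‖ = 0 := by nlinarith [norm_nonneg (fderiv ℝ F p (p - q))]
    exact sub_eq_zero.1 (hinj p hp (by rw [norm_eq_zero.1 h2, map_zero]))
  have := FiniteDimensional.proper_real V
  have himg : MeasurableSet (F '' D) := hD.image_of_continuousOn_injOn hF.continuous.continuousOn hFD
  have hHaar : (μH[(n : ℝ)] : Measure V).IsAddHaarMeasure := by
    rw [← hV]; infer_instance
  have hlf := h.isLocallyFiniteMeasure
  have hd1 := hF.ae_hausdorffMeasure_forall_fiber (Nat.cast_nonneg n)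
    (ae_tendsto_density_compl (μH[(n : ℝ)] : Measure V) hD n (Eventually.of_forall fun u =>
      ⟨μH[(n : ℝ)] (Metric.ball (0 : V) 1), measure_ball_lt_top.ne, by
        filter_upwards [self_mem_nhdsWithin] with r hr
        rw [Measure.addHaar_closedBall _ _ (le_of_lt hr), hV, mul_comm]⟩))
  have hd2 := ae_tendsto_density_compl
    ((μH[(n : ℝ)] : Measure (EuclideanSpace ℝ (Fin (n + 1)))).restrict M) himg n
    ((ae_restrict_iff' h.1.measurableSet).2 (Eventually.of_forall fun x hx =>
      h.exists_eventually_closedBall_le hx))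
  rw [ae_restrict_iff' h.1.measurableSet] at hd2
  filter_upwards [hd1, hd2] with y hy1 hy2 u hu huy
  refine ⟨hu, hD, himg, hDM.image_subset, hle u hu, ?_, hy1 u huy hu⟩
  subst huy
  refine (hy2 (hDM hu) (mem_image_of_mem F hu)).congr fun r => ?_
  rw [Measure.restrict_apply (Metric.isClosed_closedBall.measurableSet.diff himg)]
  congr 2
  ext z
  simp only [mem_inter_iff, Set.mem_sdiff]
  tauto

theorem IsAhlforsRegular.ae_exists_tangent (h : IsAhlforsRegular n M) {V : Type*}
    [NormedAddCommGroup V] [NormedSpace ℝ V] [FiniteDimensional ℝ V] [MeasurableSpace V]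
    [BorelSpace V] (hV : Module.finrank ℝ V = n) {F : V → EuclideanSpace ℝ (Fin (n + 1))}
    {L : ℝ≥0} (hF : LipschitzWith L F) {g : EuclideanSpace ℝ (Fin (n + 1)) → ℝ} {K : ℝ≥0}
    (hg : LipschitzWith K g) :
    ∀ᵐ y ∂(μH[(n : ℝ)] : Measure (EuclideanSpace ℝ (Fin (n + 1)))), ∀ u, F u = y → y ∈ M →
      ∃ P, IsApproxTangentSpace n M y P ∧ DifferentiableAt ℝ (fun w : P => g (y + w)) 0 := by
  have hHaar : (μH[(n : ℝ)] : Measure V).IsAddHaarMeasure := by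
    rw [← hV]; infer_instance
  have hdF := hF.ae_hausdorffMeasure_forall_fiber (Nat.cast_nonneg n)
    (hF.ae_differentiableAt (μ := μH[(n : ℝ)]))
  have hdgF := hF.ae_hausdorffMeasure_forall_fiber (Nat.cast_nonneg n)
    ((hg.comp hF).ae_differentiableAt (μ := μH[(n : ℝ)]))
  have hinj : ∀ᵐ y ∂(μH[(n : ℝ)] : Measure (EuclideanSpace ℝ (Fin (n + 1)))),
      ∀ u, F u = y → DifferentiableAt ℝ F u → Function.Injective (fderiv ℝ F u) := by
    rw [ae_iff]
    refine measure_mono_null ?_ (hF.hausdorffMeasure_image_not_injective_eq_zero hV)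
    intro y hy
    simp only [mem_ofPred_eq, not_forall] at hy
    obtain ⟨u, huy, hud, hui⟩ := hy
    exact ⟨u, ⟨hud, hui⟩, huy⟩
  -- The intersection with `F ⁻¹' M` is needed because an extended chart may leave `M`.
  set E : Set V := {u | DifferentiableAt ℝ F u} ∩
    (fderiv ℝ F ⁻¹' {A | Function.Injective A} ∩ F ⁻¹' M) with hE
  have hEm : MeasurableSet E := (measurableSet_of_differentiableAt ℝ F).inter
    ((measurable_fderiv ℝ F ContinuousLinearMap.isOpen_injective.measurableSet).inter
      (hF.continuous.measurable h.1.measurableSet))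
  let ε : ℕ → ℝ≥0 := fun k => 1 / (k + 2)
  have hε0 : ∀ k, 0 < ε k := fun k => by positivity
  have hε2 : ∀ k, ε k ≤ 1 / 2 := fun k => by
    refine one_div_le_one_div_of_le two_pos ?_
    exact le_add_of_nonneg_left bot_le
  have hεlim : Tendsto ε atTop (𝓝 0) := by
    rw [← NNReal.tendsto_coe]
    have := (tendsto_one_div_add_atTop_nhds_zero_nat (𝕜 := ℝ)).comp (tendsto_add_atTop_nat 1)
    refine this.congr fun k => ?_
    simp only [ε, Function.comp]
    push_cast
    ring
  have hcov := fun k => exists_countable_cover_norm_sub_le hEm (fun u hu => hu.1)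
    (fun u hu => hu.2.1) (NNReal.coe_pos.2 (hε0 k))
  choose 𝒟 h𝒟c h𝒟E h𝒟 using hcov
  have hpiece : ∀ᵐ y ∂(μH[(n : ℝ)] : Measure (EuclideanSpace ℝ (Fin (n + 1)))),
      ∀ k, ∀ D ∈ 𝒟 k, ∀ u ∈ D, F u = y → IsTangentPiece n M F (fderiv ℝ F u) u (ε k) D := by
    refine ae_all_iff.2 fun k => (ae_ball_iff (h𝒟c k)).2 fun D hD => ?_
    obtain ⟨h1, h2, h3⟩ := h𝒟 k D hD
    exact h.ae_isTangentPiece hV hF h1 (fun u hu => (h2 hu).2.2) (fun u hu => (h2 hu).2.1)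
      ((hε2 k).trans_lt (by rw [div_lt_one two_pos]; exact one_lt_two)) h3
  filter_upwards [hdF, hdgF, hinj, hpiece] with y h1 h2 h3 h4 u huy hyM
  have hud := h1 u huy
  have hui := h3 u huy hud
  have hex : ∀ k, ∃ D, IsTangentPiece n M F (fderiv ℝ F u) u (ε k) D := fun k => by
    have huE : u ∈ E := ⟨hud, hui, by rw [mem_preimage, huy]; exact hyM⟩
    obtain ⟨D, hD, huD⟩ := h𝒟E k huE
    exact ⟨D, h4 k D hD u huD huy⟩
  refine ⟨LinearMap.range (fderiv ℝ F u : V →ₗ[ℝ] EuclideanSpace ℝ (Fin (n + 1))), ⟨?_, ?_⟩, ?_⟩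
  · rw [LinearMap.finrank_range_of_inj hui, hV]
  · intro φ hφ hφc
    have := tendsto_integral_blowup hV hF.continuous.measurable hui hεlim hε0 hε2 hex
      h.isLocallyFiniteMeasure hφ hφc
    rwa [huy] at this
  · have := hg.differentiableAt_range hui hud.hasFDerivAt (h2 u huy)
    rwa [huy] at this

end Ahlfors

theorem proposition5p7 (n : ℕ) (M : Set (EuclideanSpace ℝ (Fin (n + 1))))
    (hreg : IsAhlforsRegular n M) (hrect : IsCountablyRectifiable n M)
    (f : M → ℝ) (fbar : EuclideanSpace ℝ (Fin (n + 1)) → ℝ) (K : ℝ≥0)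
    (hf : LipschitzWith K f) (hfbar : LipschitzWith K fbar)
    (hext : ∀ y : M, fbar (y : EuclideanSpace ℝ (Fin (n + 1))) = f y) :
    ∀ᵐ x ∂((μH[(n : ℝ)] : Measure (EuclideanSpace ℝ (Fin (n + 1)))).restrict M),
      ∃ hx : x ∈ M, ∃ g : EuclideanSpace ℝ (Fin (n + 1)),
        HasTangentialGradientAt n M fbar g x ∧ ‖g‖ₑ ≤ localLip f ⟨x, hx⟩ := by
  obtain ⟨-, M₀, A, F, hM₀, hF, hcov⟩ := hrect
  choose L hL using hF
  -- Charts defined on all of `ℝⁿ` make Rademacher and the density theorem available.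
  choose G hGL hGF using fun i => (hL i).extend_finite_dimension
  have hae := ae_all_iff.2 fun i =>
    hreg.ae_exists_tangent finrank_euclideanSpace_fin (hGL i) hfbar
  rw [ae_restrict_iff' hreg.1.measurableSet]
  filter_upwards [hae, measure_eq_zero_iff_ae_notMem.1 hM₀] with x hx hx₀ hxM
  obtain ⟨i, u, hu, hux⟩ := mem_iUnion.1 ((hcov hxM).resolve_left hx₀)
  obtain ⟨P, hP, hdiff⟩ := hx i u (by rw [← hGF i hu, hux]) hxM
  have hgrad := hdiff.hasGradientAt
  exact ⟨hxM, _, ⟨P, hP, _, rfl, hgrad⟩, hP.enorm_gradient_le_localLip hxM hfbar hext hgrad⟩
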